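/- Let $\lambda\in\mathbb C$ with $|\lambda|>1$ and let $\varphi$ be a $C^\infty$ diffeomorphism of $[0,\infty)$ with $\varphi(x)>x$ for all $x>0$. Put $\tilde R=\mathbb C\times[0,\infty)\setminus\{(0,0)\}$, $T(z,x)=(\lambda z,\varphi(x))$, and let $R=\tilde R/T^{\mathbb Z}$ be the resulting Reeb component, foliated by the images of the leaves $\mathbb C\times\{x\}$ $(x>0)$ and $\mathbb C^*\times\{0\}$ with their standard complex structures; write $[z,x]\in R$ for the class of $(z,x)$. Its boundary leaf is the elliptic curve $H=\mathbb C^*/\lambda^{\mathbb Z}$; write $[z]\in H$ for the class of $z\in\mathbb C^*$. Let $\mathrm{Aut}\,R$ be the group of foliation preserving $C^\infty$ diffeomorphisms of $R$ whose restriction to each leaf is holomorphic, $\mathrm{Aut}\,H$ the group of holomorphic diffeomorphisms of $H$ (not necessarily fixing a base point) with the compact-open topology, $\mathrm{Aut}_0H$ its identity component, and $r_H:\mathrm{Aut}\,R\to\mathrm{Aut}\,H$ the restriction map to the boundary leaf. **Proposition 3.1 (image of $r_H$).** The image of $r_H$ is exactly $\mathrm{Aut}_0H$. Moreover: * No $g\in\mathrm{Aut}\,H\setminus\mathrm{Aut}_0H$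 preserves the direction of the holonomy of the boundary leaf; that is, for such $g$ there is a loop $\gamma$ in $H$ along which the holonomy $h_\gamma$ is expanding ($h_\gamma(x)>x$ for $x>0$) while the holonomy along $g\circ\gamma$ is not expanding. Here the holonomy along $\gamma$ is defined by lifting $\gamma$ to a path $c:[0,1]\to\mathbb C^*$ and requiring $[c(1),x]=[c(0),h_\gamma(x)]$ in $R$ for all $x\ge 0$. * $\mathrm{Aut}_0H$ consists exactly of the translations $h\mapsto t h$ $(t\in H)$ of the group $H=\mathbb C^*/\lambda^{\mathbb Z}$. * Every translation of $H$ is induced by $z\mapsto az$ for some $a\in\mathbb C^*$, and for a suitable such $a$ the map $(z,x)\mapsto(az,x)$ of $\tilde R$ descends to an element of $\mathrm{Aut}\,R$ whose restriction to $H$ is the given translation. -/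

import Mathlib

open Set Filter Topology
open scoped NNReal ContDiff

noncomputable section

/-- The data of the Hopf construction in complex leaf dimension one: a multiplier `lam` with
`|lam| > 1` and an expanding smooth diffeomorphism `φ` of the half line `[0, ∞)`. -/
structure HopfData where
  lam : ℂˣ
  one_lt_norm : 1 < ‖(lam : ℂ)‖
  φ : Equiv.Perm ℝ≥0
  smooth : ContDiffOn ℝ ∞ (fun x : ℝ => (φ x.toNNReal : ℝ)) (Ici 0)
  smooth_symm : ContDiffOn ℝ ∞ (fun x : ℝ => (φ.symm x.toNNReal : ℝ)) (Ici 0)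
  expanding : ∀ x : ℝ≥0, 0 < x → x < φ x

namespace HopfData

/-- The space `R̃ = ℂ × [0, ∞) ∖ {(0, 0)}`. -/
abbrev Cover : Type := {p : ℂ × ℝ≥0 // p ≠ 0}

/-- The coordinates of a point of `R̃` in `ℂ × ℝ`. -/
def coord (p : Cover) : ℂ × ℝ := (p.1.1, (p.1.2 : ℝ))

/-- The closed half space `ℂ × [0, ∞)` in `ℂ × ℝ`. -/
def halfSpace : Set (ℂ × ℝ) := {q | 0 ≤ q.2}

/-- The point `(z, 0)` of `R̃`, for `z ∈ ℂ*`. -/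
def bdryPt (z : ℂˣ) : Cover :=
  ⟨((z : ℂ), 0), fun h => z.ne_zero (congrArg Prod.fst h)⟩

/-- The map `m_a × id` of `R̃`, for `a ∈ ℂ*`. -/
def scale (a : ℂˣ) (p : Cover) : Cover :=
  ⟨((a : ℂ) * p.1.1, p.1.2), fun h => p.2 (Prod.ext
    ((mul_eq_zero.mp (Prod.ext_iff.mp h).1).resolve_left a.ne_zero) (Prod.ext_iff.mp h).2)⟩

variable (D : HopfData)

theorem φ_zero : D.φ 0 = 0 := by
  by_contra h
  have h1 : D.φ.symm 0 ≠ 0 := fun h2 => h (by rw [← h2, Equiv.apply_symm_apply, h2])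
  have h2 := D.expanding _ (pos_iff_ne_zero.mpr h1)
  rw [Equiv.apply_symm_apply] at h2
  exact absurd h2 (not_lt.mpr (zero_le))

theorem φ_symm_zero : D.φ.symm 0 = 0 := by
  rw [Equiv.symm_apply_eq, D.φ_zero]

/-- The covering transformation `T(z, x) = (lam * z, φ x)` of `R̃`. -/
def T : Equiv.Perm Cover where
  toFun p := ⟨((D.lam : ℂ) * p.1.1, D.φ p.1.2), fun h => p.2 (Prod.ext
    ((mul_eq_zero.mp (congrArg Prod.fst h)).resolve_left D.lam.ne_zero)
    (D.φ.injective ((congrArg Prod.snd h).trans D.φ_zero.symm)))⟩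
  invFun p := ⟨(((D.lam⁻¹ : ℂˣ) : ℂ) * p.1.1, D.φ.symm p.1.2), fun h => p.2 (Prod.ext
    ((mul_eq_zero.mp (congrArg Prod.fst h)).resolve_left (D.lam⁻¹).ne_zero)
    (D.φ.symm.injective ((congrArg Prod.snd h).trans D.φ_symm_zero.symm)))⟩
  left_inv p := Subtype.ext (Prod.ext (by simp) (by simp))
  right_inv p := Subtype.ext (Prod.ext (by simp) (by simp))

theorem T_zpow (k : ℤ) (p : Cover) :
    ((D.T ^ k) p).1 = (((D.lam ^ k : ℂˣ) : ℂ) * p.1.1, (D.φ ^ k) p.1.2) := by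
  induction k using Int.induction_on generalizing p with
  | zero => simp
  | succ n ih =>
    rw [zpow_add_one, Equiv.Perm.mul_apply, ih, zpow_add_one, zpow_add_one]
    simp [T, mul_assoc]
  | pred n ih =>
    rw [zpow_sub_one, Equiv.Perm.mul_apply, ih, zpow_sub_one, zpow_sub_one]
    refine Prod.ext ?_ rfl
    change _ * ((((D.lam⁻¹ : ℂˣ)) : ℂ) * p.1.1) = _
    push_cast
    ring

/-- The Reeb component `R = R̃ / T^ℤ`, with the quotient topology. -/
abbrev R : Type := MulAction.orbitRel.Quotient (Subgroup.zpowers D.T) Cover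

instance : TopologicalSpace D.R := inferInstanceAs (TopologicalSpace (Quotient _))

/-- The covering projection `R̃ → R`. -/
def π (p : Cover) : D.R := Quotient.mk _ p

theorem π_eq {p q : Cover} : D.π p = D.π q ↔ ∃ k : ℤ, (D.T ^ k) q = p := by
  refine Quotient.eq.trans ?_
  rw [MulAction.orbitRel_apply, MulAction.mem_orbit_iff]
  constructor
  · rintro ⟨⟨g, k, rfl⟩, h⟩
    exact ⟨k, h⟩
  · rintro ⟨k, h⟩
    exact ⟨⟨_, k, rfl⟩, h⟩

/-- The elliptic curve `H = ℂ* / lam^ℤ`, with its quotient topology and group structure. -/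
abbrev H : Type := ℂˣ ⧸ Subgroup.zpowers D.lam

/-- The covering projection `ℂ* → H`. -/
def πH (z : ℂˣ) : D.H := QuotientGroup.mk z

theorem πH_eq {z w : ℂˣ} : D.πH z = D.πH w ↔ ∃ k : ℤ, D.lam ^ k * w = z := by
  refine QuotientGroup.eq.trans ⟨?_, ?_⟩
  · rintro ⟨k, hk⟩
    refine ⟨-k, ?_⟩
    simp only at hk
    rw [zpow_neg, hk]
    simp
  · rintro ⟨k, rfl⟩
    exact ⟨-k, by simp [zpow_neg]⟩

theorem π_bdryPt_eq {z w : ℂˣ} : D.π (bdryPt z) = D.π (bdryPt w) ↔ D.πH z = D.πH w := by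
  rw [D.π_eq, D.πH_eq]
  refine exists_congr fun k => ?_
  have h0 : (D.φ ^ k) 0 = 0 :=
    Function.IsFixedPt.perm_zpow (e := D.φ) (x := (0 : ℝ≥0)) D.φ_zero k
  rw [Subtype.ext_iff, D.T_zpow, Units.ext_iff, Prod.ext_iff]
  simp [bdryPt, h0]

/-- The identification of `H` with the boundary `{x = 0}` of `R`, `[z] ↦ [(z, 0)]`. -/
def bdry : D.H → D.R :=
  Quotient.lift (fun z => D.π (bdryPt z)) fun _ _ h => D.π_bdryPt_eq.mpr (Quotient.sound h)

theorem bdry_πH (z : ℂˣ) : D.bdry (D.πH z) = D.π (bdryPt z) := rfl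

theorem πH_surjective : Function.Surjective D.πH := QuotientGroup.mk_surjective

theorem bdry_injective : Function.Injective D.bdry := by
  intro a b h
  obtain ⟨z, rfl⟩ := D.πH_surjective a
  obtain ⟨w, rfl⟩ := D.πH_surjective b
  exact D.π_bdryPt_eq.mp h

/-- The leaf of `R` through the height `x`: the image of `ℂ × {x}` if `x > 0`, and of
`ℂ* × {0}` if `x = 0`. -/
def leaf (x : ℝ≥0) : Set D.R := D.π '' {p | p.1.2 = x}

theorem range_bdry : range D.bdry = D.leaf 0 := by
  ext a
  constructor
  · rintro ⟨h, rfl⟩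
    obtain ⟨z, rfl⟩ := D.πH_surjective h
    exact ⟨bdryPt z, rfl, rfl⟩
  · rintro ⟨⟨⟨z, x⟩, hp⟩, hx, rfl⟩
    have hx : x = 0 := hx
    subst hx
    exact ⟨D.πH (Units.mk0 z fun h => hp (by rw [h]; rfl)), rfl⟩

/-- `f` maps every leaf onto a leaf. -/
def PreservesFoliation (f : D.R → D.R) : Prop := ∀ x, ∃ y, f '' D.leaf x = D.leaf y

/-- `f` is of class `C^∞`, up to the boundary: near every point it lifts to a map `F` of `R̃`
which is `C^∞` in the coordinates of `R̃`. -/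
def IsSmooth (f : D.R → D.R) : Prop :=
  ∀ p : Cover, ∃ F : ℂ × ℝ → ℂ × ℝ, ContDiffWithinAt ℝ ∞ F halfSpace (coord p) ∧
    ∀ᶠ q in 𝓝 p, ∃ q' : Cover, coord q' = F (coord q) ∧ f (D.π q) = D.π q'

/-- `f` is holomorphic along the leaves: near every point of a leaf, in the leaf coordinates
`z ↦ [(z, x)]` of the source and `z ↦ [(z, y)]` of the target, it is a holomorphic function. -/
def IsLeafwiseHolomorphic (f : D.R → D.R) : Prop :=
  ∀ p : Cover, ∃ (g : ℂ → ℂ) (y : ℝ≥0), AnalyticAt ℂ g p.1.1 ∧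
    ∀ᶠ w in 𝓝 p.1.1, ∀ hw : (w, p.1.2) ≠ 0, ∃ hg : (g w, y) ≠ 0,
      f (D.π ⟨(w, p.1.2), hw⟩) = D.π ⟨(g w, y), hg⟩

/-- `f` is a smooth, foliation preserving, leafwise holomorphic map. -/
structure IsFoliatedHolomorphic (f : D.R → D.R) : Prop where
  smooth : D.IsSmooth f
  foliation : D.PreservesFoliation f
  holomorphic : D.IsLeafwiseHolomorphic f

/-- `f : H → H` is holomorphic: near every point it lifts to a holomorphic map into `ℂ*`. -/
def IsHolomorphic (f : D.H → D.H) : Prop :=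
  ∀ z : ℂˣ, ∃ F : ℂ → ℂ, AnalyticAt ℂ F (z : ℂ) ∧
    ∀ᶠ w : ℂˣ in 𝓝 z, ∃ v : ℂˣ, (v : ℂ) = F (w : ℂ) ∧ f (D.πH w) = D.πH v

variable {D}

theorem continuous_coord : Continuous coord := by
  unfold coord; fun_prop

theorem isEmbedding_coord : IsEmbedding coord :=
  (IsEmbedding.id.prodMap NNReal.isEmbedding_coe).comp IsEmbedding.subtypeVal

theorem coord_mem (p : Cover) : coord p ∈ halfSpace := p.1.2.2

theorem tendsto_lift {p p' : Cover} {F : ℂ × ℝ → ℂ × ℝ} {u : Cover → Cover}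
    (hF : ContinuousWithinAt F halfSpace (coord p)) (hp : coord p' = F (coord p))
    (hu : ∀ᶠ q in 𝓝 p, coord (u q) = F (coord q)) : Tendsto u (𝓝 p) (𝓝 p') := by
  rw [isEmbedding_coord.tendsto_nhds_iff, hp]
  refine Tendsto.congr' (hu.mono fun q hq => hq.symm) ?_
  exact hF.tendsto.comp (tendsto_nhdsWithin_iff.mpr
    ⟨continuous_coord.continuousAt, Eventually.of_forall coord_mem⟩)

theorem IsSmooth.comp {f g : D.R → D.R} (hf : D.IsSmooth f) (hg : D.IsSmooth g) :
    D.IsSmooth (f ∘ g) := by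
  intro p
  obtain ⟨G, hG, hG'⟩ := hg p
  obtain ⟨p', hp', -⟩ := hG'.self_of_nhds
  obtain ⟨F, hF, hF'⟩ := hf p'
  have : ∃ u : Cover → Cover, ∀ᶠ q in 𝓝 p, coord (u q) = G (coord q) ∧ g (D.π q) = D.π (u q) := by
    classical
    refine ⟨fun q => if h : ∃ q' : Cover, coord q' = G (coord q) ∧ g (D.π q) = D.π q'
      then h.choose else q, hG'.mono fun q hq => ?_⟩
    simp only [dif_pos hq]
    exact hq.choose_spec
  obtain ⟨u, hu⟩ := this
  have hut : Tendsto u (𝓝 p) (𝓝 p') :=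
    tendsto_lift hG.continuousWithinAt hp' (hu.mono fun _ h => h.1)
  -- modify `G` off the image of `R̃` so that it maps into the half space
  have hmem : G ⁻¹' halfSpace ∈ 𝓝[halfSpace] (coord p) := by
    have h0 : coord p ≠ 0 := fun h => p.2 (Prod.ext (Prod.ext_iff.mp h).1
      (NNReal.coe_injective (Prod.ext_iff.mp h).2))
    have hr : range coord ∈ 𝓝[halfSpace] (coord p) := by
      refine mem_nhdsWithin.mpr ⟨{0}ᶜ, isOpen_compl_singleton, h0, ?_⟩
      rintro ⟨z, x⟩ ⟨hz, hx⟩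
      refine ⟨⟨(z, ⟨x, hx⟩), fun h => hz (Prod.ext (Prod.ext_iff.mp h).1
        (congrArg NNReal.toReal (Prod.ext_iff.mp h).2))⟩, rfl⟩
    have hsub : halfSpace ∈ 𝓝[halfSpace] (coord p) := self_mem_nhdsWithin
    obtain ⟨V, hV, hV'⟩ := (isEmbedding_coord.nhds_eq_comap p ▸ hu :
      ∀ᶠ q in comap coord (𝓝 (coord p)), _)
    filter_upwards [hr, mem_nhdsWithin_of_mem_nhds hV] with q hq hqV
    obtain ⟨r, rfl⟩ := hq
    have := (hV' hqV).1
    change G (coord r) ∈ halfSpace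
    rw [← this]
    exact coord_mem _
  refine ⟨F ∘ G, ?_, ?_⟩
  · rw [hp'] at hF
    exact hF.comp_of_preimage_mem_nhdsWithin _ hG hmem
  · filter_upwards [hu, hut.eventually hF'] with q h1 h2
    obtain ⟨q', h3, h4⟩ := h2
    exact ⟨q', by rw [h3, h1.1]; rfl, by rw [Function.comp_apply, h1.2, h4]⟩

theorem IsLeafwiseHolomorphic.comp {f g : D.R → D.R} (hf : D.IsLeafwiseHolomorphic f)
    (hg : D.IsLeafwiseHolomorphic g) : D.IsLeafwiseHolomorphic (f ∘ g) := by
  intro p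
  obtain ⟨G, y, hG, hG'⟩ := hg p
  obtain ⟨hp', -⟩ := hG'.self_of_nhds p.2
  obtain ⟨F, y', hF, hF'⟩ := hf ⟨(G p.1.1, y), hp'⟩
  refine ⟨F ∘ G, y', AnalyticAt.comp (g := F) (f := G) hF hG, ?_⟩
  filter_upwards [hG', hG.continuousAt.tendsto.eventually hF'] with w h1 h2 hw
  obtain ⟨h3, h4⟩ := h1 hw
  obtain ⟨h5, h6⟩ := h2 h3
  exact ⟨h5, by rw [Function.comp_apply, h4, h6]; rfl⟩

theorem PreservesFoliation.comp {f g : D.R → D.R} (hf : D.PreservesFoliation f)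
    (hg : D.PreservesFoliation g) : D.PreservesFoliation (f ∘ g) := by
  intro x
  obtain ⟨y, hy⟩ := hg x
  obtain ⟨y', hy'⟩ := hf y
  exact ⟨y', by rw [image_comp, hy, hy']⟩

theorem IsFoliatedHolomorphic.comp {f g : D.R → D.R} (hf : D.IsFoliatedHolomorphic f)
    (hg : D.IsFoliatedHolomorphic g) : D.IsFoliatedHolomorphic (f ∘ g) :=
  ⟨hf.smooth.comp hg.smooth, hf.foliation.comp hg.foliation, hf.holomorphic.comp hg.holomorphic⟩

theorem IsFoliatedHolomorphic.id : D.IsFoliatedHolomorphic id where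
  smooth _ := ⟨_root_.id, contDiffWithinAt_id, Eventually.of_forall fun q => ⟨q, rfl, rfl⟩⟩
  foliation x := ⟨x, image_id _⟩
  holomorphic p := ⟨_root_.id, p.1.2, analyticAt_id,
    Eventually.of_forall fun _ hw => ⟨hw, rfl⟩⟩

theorem IsHolomorphic.id : D.IsHolomorphic id :=
  fun _ => ⟨_root_.id, analyticAt_id, Eventually.of_forall fun w => ⟨w, rfl, rfl⟩⟩

/-- A pointwise lift with values in `ℂ*` of a function which is continuous at `z` converges. -/
theorem tendsto_liftH {z v : ℂˣ} {F : ℂ → ℂ} {u : ℂˣ → ℂˣ} (hF : ContinuousAt F (z : ℂ))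
    (hv : (v : ℂ) = F z) (hu : ∀ᶠ w in 𝓝 z, (u w : ℂ) = F w) : Tendsto u (𝓝 z) (𝓝 v) := by
  rw [Units.isEmbedding_val₀.tendsto_nhds_iff, hv]
  exact Tendsto.congr' (hu.mono fun q hq => hq.symm)
    (hF.tendsto.comp Units.continuous_val.continuousAt)

theorem exists_liftH {f : D.H → D.H} {z : ℂˣ} {F : ℂ → ℂ}
    (h : ∀ᶠ w : ℂˣ in 𝓝 z, ∃ v : ℂˣ, (v : ℂ) = F (w : ℂ) ∧ f (D.πH w) = D.πH v) :
    ∃ u : ℂˣ → ℂˣ, ∀ᶠ w in 𝓝 z, (u w : ℂ) = F w ∧ f (D.πH w) = D.πH (u w) := by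
  classical
  refine ⟨fun w => if h : ∃ v : ℂˣ, (v : ℂ) = F w ∧ f (D.πH w) = D.πH v
    then h.choose else w, h.mono fun q hq => ?_⟩
  simp only [dif_pos hq]
  exact hq.choose_spec

theorem IsHolomorphic.comp {f g : D.H → D.H} (hf : D.IsHolomorphic f) (hg : D.IsHolomorphic g) :
    D.IsHolomorphic (f ∘ g) := by
  intro z
  obtain ⟨G, hG, hG'⟩ := hg z
  obtain ⟨v, hv, -⟩ := hG'.self_of_nhds
  obtain ⟨F, hF, hF'⟩ := hf v
  obtain ⟨u, hu⟩ := exists_liftH hG'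
  have hut := tendsto_liftH hG.continuousAt hv (hu.mono fun _ h => h.1)
  rw [hv] at hF
  refine ⟨F ∘ G, hF.comp hG, ?_⟩
  filter_upwards [hu, hut.eventually hF'] with w h1 h2
  obtain ⟨v', h3, h4⟩ := h2
  exact ⟨v', by rw [h3, h1.1]; rfl, by rw [Function.comp_apply, h1.2, h4]⟩

theorem continuous_πH : Continuous D.πH := continuous_quot_mk

theorem continuous_π : Continuous D.π := continuous_quot_mk

theorem IsHolomorphic.continuous {f : D.H → D.H} (hf : D.IsHolomorphic f) : Continuous f := by
  have hq : IsQuotientMap D.πH := isQuotientMap_quot_mk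
  refine hq.continuous_iff.mpr ?_
  refine continuous_iff_continuousAt.mpr fun z => ?_
  obtain ⟨F, hF, hF'⟩ := hf z
  obtain ⟨v, hv, hv'⟩ := hF'.self_of_nhds
  obtain ⟨u, hu⟩ := exists_liftH hF'
  have hut := tendsto_liftH hF.continuousAt hv (hu.mono fun _ h => h.1)
  change Tendsto _ _ (𝓝 (f (D.πH z)))
  rw [hv']
  exact Tendsto.congr' (hu.mono fun w hw => hw.2.symm)
    ((continuous_πH (D := D)).continuousAt.tendsto.comp hut)

variable (D)

/-- The group `Aut R` of foliation preserving diffeomorphisms of `R` whose restriction to each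
leaf is holomorphic. -/
def AutR : Subgroup (D.R ≃ₜ D.R) where
  carrier := {f | D.IsFoliatedHolomorphic f ∧ D.IsFoliatedHolomorphic f.symm}
  mul_mem' := fun hf hg => ⟨hf.1.comp hg.1, hg.2.comp hf.2⟩
  one_mem' := ⟨IsFoliatedHolomorphic.id, IsFoliatedHolomorphic.id⟩
  inv_mem' := fun hf => ⟨hf.2, hf.1⟩

/-- The group `Aut H` of holomorphic diffeomorphisms of the elliptic curve `H` (as a complex
curve, without base point). -/
def AutH : Subgroup (D.H ≃ₜ D.H) where
  carrier := {f | D.IsHolomorphic f ∧ D.IsHolomorphic f.symm}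
  mul_mem' := fun hf hg => ⟨hf.1.comp hg.1, hg.2.comp hf.2⟩
  one_mem' := ⟨IsHolomorphic.id, IsHolomorphic.id⟩
  inv_mem' := fun hf => ⟨hf.2, hf.1⟩

/-- The compact-open topology on `Aut H`. -/
instance : TopologicalSpace D.AutH :=
  TopologicalSpace.induced (fun f : D.AutH => (f.1 : C(D.H, D.H))) inferInstance

/-- The identity component `Aut₀ H` of `Aut H`. -/
def Aut₀H : Set D.AutH := connectedComponent 1

/-! ### The boundary leaf is preserved by every automorphism of `R` -/

theorem isClosed_leaf_zero : IsClosed (D.leaf 0) := by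
  have hq : IsQuotientMap D.π := isQuotientMap_quot_mk
  refine hq.isClosed_preimage.mp ?_
  have : D.π ⁻¹' D.leaf 0 = {p : Cover | p.1.2 = 0} := by
    ext p
    constructor
    · rintro ⟨q, hq, h⟩
      obtain ⟨k, hk⟩ := D.π_eq.mp h.symm
      have h2 := congrArg Prod.snd (D.T_zpow k q)
      rw [hk, show q.1.2 = 0 from hq] at h2
      exact h2.trans (Function.IsFixedPt.perm_zpow (e := D.φ) (x := (0 : ℝ≥0)) D.φ_zero k)
    · exact fun hp => ⟨p, hp, rfl⟩
  rw [this]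
  exact isClosed_eq (by fun_prop) continuous_const

theorem φ_symm_le (x : ℝ≥0) : D.φ.symm x ≤ x := by
  rcases eq_or_ne (D.φ.symm x) 0 with h | h
  · rw [h]; exact zero_le
  · have := D.expanding _ (pos_iff_ne_zero.mpr h)
    rw [Equiv.apply_symm_apply] at this
    exact this.le

theorem continuous_φ_symm : Continuous D.φ.symm := by
  have h : Continuous fun x : ℝ≥0 => (D.φ.symm (x : ℝ).toNNReal : ℝ) :=
    D.smooth_symm.continuousOn.comp_continuous NNReal.continuous_coe fun x => x.2
  simp only [Real.toNNReal_coe] at h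
  exact NNReal.isEmbedding_coe.continuous_iff.mpr h

theorem tendsto_φ_symm_iterate (x : ℝ≥0) :
    Tendsto (fun n : ℕ => D.φ.symm^[n] x) atTop (𝓝 0) := by
  have hanti : Antitone fun n : ℕ => D.φ.symm^[n] x := antitone_nat_of_succ_le fun n => by
    rw [Function.iterate_succ_apply']; exact D.φ_symm_le _
  have hlim := tendsto_atTop_ciInf hanti (OrderBot.bddBelow _)
  have hfix := isFixedPt_of_tendsto_iterate hlim D.continuous_φ_symm.continuousAt
  have h0 : (⨅ n : ℕ, D.φ.symm^[n] x) = 0 := by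
    by_contra h
    have h1 := D.expanding _ (pos_iff_ne_zero.mpr h)
    rw [show D.φ _ = _ from (D.φ.symm_apply_eq.mp hfix).symm] at h1
    exact lt_irrefl _ h1
  rwa [h0] at hlim

theorem eq_zero_of_isClosed_leaf {x : ℝ≥0} (h : IsClosed (D.leaf x)) : x = 0 := by
  have hpt : Tendsto (fun n : ℕ => (⟨(1, D.φ.symm^[n] x), by simp⟩ : Cover)) atTop
      (𝓝 (bdryPt 1)) := by
    rw [tendsto_subtype_rng]
    exact tendsto_const_nhds.prodMk_nhds (D.tendsto_φ_symm_iterate x)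
  have hπ := ((continuous_π (D := D)).continuousAt.tendsto).comp hpt
  have hmem : D.π (bdryPt 1) ∈ D.leaf x := by
    refine h.mem_of_tendsto hπ (Eventually.of_forall fun n => ?_)
    refine ⟨(D.T ^ (n : ℤ)) ⟨(1, D.φ.symm^[n] x), by simp⟩, ?_, D.π_eq.mpr ⟨n, rfl⟩⟩
    change ((D.T ^ (n : ℤ)) _).1.2 = x
    rw [D.T_zpow]
    change (D.φ ^ (n : ℤ)) (D.φ.symm^[n] x) = x
    rw [zpow_natCast, ← Equiv.Perm.iterate_eq_pow]
    exact (D.φ.symm.leftInverse_symm).iterate n x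
  obtain ⟨q, hq, hq'⟩ := hmem
  obtain ⟨k, hk⟩ := D.π_eq.mp hq'
  have h2 := congrArg Prod.snd (D.T_zpow k (bdryPt 1))
  rw [hk] at h2
  rw [← show q.1.2 = x from hq, h2]
  exact Function.IsFixedPt.perm_zpow (e := D.φ) (x := (0 : ℝ≥0)) D.φ_zero k

variable {D}

theorem image_leaf_zero (f : D.AutR) : f.1 '' D.leaf 0 = D.leaf 0 := by
  obtain ⟨y, hy⟩ := f.2.1.foliation 0
  have hc : IsClosed (D.leaf y) := by
    rw [← hy]; exact f.1.isClosed_image.mpr D.isClosed_leaf_zero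
  rw [D.eq_zero_of_isClosed_leaf hc] at hy
  exact hy

theorem exists_restrict (f : D.AutR) (h : D.H) : ∃ h' : D.H, D.bdry h' = f.1 (D.bdry h) := by
  have : f.1 (D.bdry h) ∈ D.leaf 0 := by
    rw [← image_leaf_zero f]
    exact mem_image_of_mem _ (D.range_bdry ▸ mem_range_self h)
  rwa [← D.range_bdry] at this

/-- The restriction of an automorphism of `R` to the boundary leaf, as a map `H → H`. -/
def restrictFun (f : D.AutR) (h : D.H) : D.H := (exists_restrict f h).choose

theorem bdry_restrictFun (f : D.AutR) (h : D.H) :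
    D.bdry (restrictFun f h) = f.1 (D.bdry h) := (exists_restrict f h).choose_spec

theorem isHolomorphic_restrictFun (f : D.AutR) : D.IsHolomorphic (restrictFun f) := by
  intro z
  obtain ⟨g, y, hg, hg'⟩ := f.2.1.holomorphic (bdryPt z)
  have key : ∀ {w : ℂˣ} {hg : (g w, y) ≠ 0},
      f.1 (D.π (bdryPt w)) = D.π ⟨(g w, y), hg⟩ → y = 0 := by
    intro w hgw h
    have h1 : D.π ⟨(g w, y), hgw⟩ ∈ D.leaf 0 := by
      rw [← h, ← image_leaf_zero f]
      exact mem_image_of_mem _ ⟨_, rfl, rfl⟩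
    obtain ⟨q, hq, hq'⟩ := h1
    obtain ⟨k, hk⟩ := D.π_eq.mp hq'.symm
    have h2 := congrArg Prod.snd (D.T_zpow k q)
    rw [hk, show q.1.2 = 0 from hq] at h2
    exact h2.trans (Function.IsFixedPt.perm_zpow (e := D.φ) (x := (0 : ℝ≥0)) D.φ_zero k)
  refine ⟨g, hg, ?_⟩
  filter_upwards [Units.continuous_val.continuousAt.eventually hg'] with w hw
  obtain ⟨h1, h2⟩ := hw (bdryPt w).2
  have h2 : f.1 (D.π (bdryPt w)) = D.π ⟨(g w, y), h1⟩ := h2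
  obtain rfl := key h2
  refine ⟨Units.mk0 (g w) fun h => h1 (by rw [h]; rfl), rfl, D.bdry_injective ?_⟩
  rw [bdry_restrictFun, bdry_πH, h2]
  rfl

theorem restrictFun_mul (f g : D.AutR) (h : D.H) :
    restrictFun (f * g) h = restrictFun f (restrictFun g h) := by
  apply D.bdry_injective
  rw [bdry_restrictFun, bdry_restrictFun, bdry_restrictFun]
  rfl

theorem restrictFun_one (h : D.H) : restrictFun (1 : D.AutR) h = h := by
  apply D.bdry_injective
  rw [bdry_restrictFun]
  rfl

variable (D)

/-- The restriction map `r_H : Aut R → Aut H`. -/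
def rH : D.AutR →* D.AutH where
  toFun f := ⟨{ toFun := restrictFun f
                invFun := restrictFun f⁻¹
                left_inv := fun h => by rw [← restrictFun_mul, inv_mul_cancel, restrictFun_one]
                right_inv := fun h => by rw [← restrictFun_mul, mul_inv_cancel, restrictFun_one]
                continuous_toFun := (isHolomorphic_restrictFun f).continuous
                continuous_invFun := (isHolomorphic_restrictFun f⁻¹).continuous },
    isHolomorphic_restrictFun f, isHolomorphic_restrictFun f⁻¹⟩
  map_one' := Subtype.ext (Homeomorph.ext fun h => restrictFun_one h)
  map_mul' f g := Subtype.ext (Homeomorph.ext fun h => restrictFun_mul f g h)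

/-- The defining property of `r_H`: `r_H f` is `f` on the boundary leaf. -/
theorem bdry_rH (f : D.AutR) (h : D.H) : D.bdry ((D.rH f).1 h) = f.1 (D.bdry h) :=
  bdry_restrictFun f h

/-! ### Holonomy of the boundary leaf -/

/-- `h : [0, ∞) → [0, ∞)` is the holonomy of the loop `γ` in the boundary leaf `H`: if `γ` is
lifted to a path `c` in `ℂ*`, then moving inside the leaves of the product foliation of `R̃` along
`c` takes the point `[(c 0, x)]` of the transversal `{[(c 0, x)] | x ≥ 0}` to `[(c 1, x)]`,
which is the point `[(c 0, h x)]` of the same transversal. -/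
def IsHolonomy {b : D.H} (γ : Path b b) (h : ℝ≥0 → ℝ≥0) : Prop :=
  ∃ c : C(unitInterval, ℂˣ), (∀ t, D.πH (c t) = γ t) ∧
    ∀ x : ℝ≥0, D.π ⟨((c 1 : ℂ), x), fun e => (c 1).ne_zero (congrArg Prod.fst e)⟩ =
      D.π ⟨((c 0 : ℂ), h x), fun e => (c 0).ne_zero (congrArg Prod.fst e)⟩

/-- The loop `γ` has expanding holonomy. -/
def HasExpandingHolonomy {b : D.H} (γ : Path b b) : Prop :=
  ∃ h : ℝ≥0 → ℝ≥0, D.IsHolonomy γ h ∧ ∀ x, 0 < x → x < h x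

/-- `g` preserves the direction of the holonomy of the boundary leaf: it maps loops along which
the holonomy is expanding to loops along which the holonomy is expanding. -/
def PreservesHolonomyDirection (g : D.AutH) : Prop :=
  ∀ (b : D.H) (γ : Path b b), D.HasExpandingHolonomy γ →
    D.HasExpandingHolonomy (γ.map g.1.continuous)

end HopfData

end

noncomputable section

namespace HopfData

variable (D : HopfData)

/-! ### Iterates of the expanding diffeomorphism -/

/-! Everything is read off the universal covering `ℂ → H`, `u ↦ [exp u]`, whose deck group is the
lattice of periods `k log lam + 2πi m`. By Liouville, a holomorphic self-map of `H` lifts to an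
affine map `αu + β`, and `α` maps periods to periods (`IsHolomorphic.exists_affine_lift`,
`exists_mul_period`). Translations are the maps with `α = 1`.

The holonomy along a loop with period `(k, m)` is `φ^(-k)`, so it expands exactly when `k < 0`.
Suppose `α` sends every period `(-1, m)` to one with negative exponent. The image exponent is affine
in `m`, hence constant, so `α * 2πi` is an integer multiple of `2πi` and `α` is a positive integer.
Injectivity on `H` leaves only `α = 1` (`eq_translation_of_affine_lift`).

Two situations supply this sign condition. For `g` preserving the direction of the holonomy it comes
from the definition, applied to straight loops. For the restriction of an automorphism of `R` it
comes from dynamics: on a lift to `ℂ × ℝ`, the deck transformation that contracts heights towards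
`0` is carried to `T^k'`. If `k' ≥ 0`, image heights would not decrease along heights tending to
`0`, although the boundary leaf goes to itself and no interior leaf does (`period_neg_of_AutR`).

The translations form the identity component because they are connected, as a continuous image of
`H`, and clopen. If `α ≠ 1`, then `x ↦ g x * x⁻¹` is onto `H`, so a `g` for which this map omits a
point is a translation, and omitting a given point is an open condition. Conversely each translation
extends to `R`, since `(z, x) ↦ (a z, x)` commutes with `T`. -/

theorem continuous_φ : Continuous D.φ := by
  have h : Continuous fun x : ℝ≥0 => (D.φ (x : ℝ).toNNReal : ℝ) :=
    D.smooth.continuousOn.comp_continuous NNReal.continuous_coe fun x => x.2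
  simp only [Real.toNNReal_coe] at h
  exact NNReal.isEmbedding_coe.continuous_iff.mpr h

theorem strictMono_φ : StrictMono D.φ := by
  refine (D.continuous_φ.strictMono_of_inj D.φ.injective).resolve_right fun h => ?_
  have h1 := h (zero_lt_one (α := ℝ≥0))
  rw [D.φ_zero] at h1
  exact not_lt_zero h1

theorem le_φ (x : ℝ≥0) : x ≤ D.φ x := by
  rcases eq_or_ne x 0 with rfl | h
  · exact zero_le
  · exact (D.expanding x (pos_iff_ne_zero.mpr h)).le

theorem φ_zpow_zero (k : ℤ) : (D.φ ^ k) 0 = 0 :=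
  Function.IsFixedPt.perm_zpow (e := D.φ) (x := (0 : ℝ≥0)) D.φ_zero k

theorem le_φ_pow (n : ℕ) (x : ℝ≥0) : x ≤ (D.φ ^ n) x := by
  induction n with
  | zero => simp
  | succ n ih =>
    rw [pow_succ', Equiv.Perm.mul_apply]
    exact ih.trans (D.le_φ _)

theorem φ_le_φ_zpow {k : ℤ} (hk : 0 < k) (x : ℝ≥0) : D.φ x ≤ (D.φ ^ k) x := by
  obtain ⟨n, rfl⟩ : ∃ n : ℕ, k = n + 1 := ⟨(k - 1).toNat, by omega⟩
  rw [zpow_add_one, Equiv.Perm.mul_apply, zpow_natCast]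
  exact D.le_φ_pow n _

theorem φ_zpow_neg_apply (k : ℤ) (x : ℝ≥0) : (D.φ ^ (-k)) ((D.φ ^ k) x) = x := by
  rw [← Equiv.Perm.mul_apply, ← zpow_add, neg_add_cancel, zpow_zero, Equiv.Perm.one_apply]

/-- Expansion at a single positive point already determines the sign of the exponent; a holonomy can
therefore be tested at `x = 1`. -/
theorem lt_φ_zpow_iff {k : ℤ} {x : ℝ≥0} (hx : 0 < x) : x < (D.φ ^ k) x ↔ 0 < k := by
  refine ⟨fun h => ?_, fun h => (D.expanding x hx).trans_le (D.φ_le_φ_zpow h x)⟩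
  by_contra! hk
  rcases hk.eq_or_lt with rfl | hk
  · simp at h
  · have h1 := D.φ_le_φ_zpow (neg_pos.mpr hk) ((D.φ ^ k) x)
    rw [D.φ_zpow_neg_apply] at h1
    exact absurd (h.trans_le ((D.le_φ _).trans h1)) (lt_irrefl _)

theorem continuous_φ_zpow (k : ℤ) : Continuous (D.φ ^ k) := by
  induction k using Int.induction_on with
  | zero => exact continuous_id
  | succ n ih => rw [zpow_add_one]; exact ih.comp D.continuous_φ
  | pred n ih => rw [zpow_sub_one]; exact ih.comp D.continuous_φ_symm

/-! ### The covering maps `R̃ → R` and `ℂ* → H` -/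

theorem norm_zpow_lam_lt_iff {k l : ℤ} :
    ‖((D.lam ^ k : ℂˣ) : ℂ)‖ < ‖((D.lam ^ l : ℂˣ) : ℂ)‖ ↔ k < l := by
  push_cast
  rw [norm_zpow, norm_zpow]
  exact zpow_lt_zpow_iff_right₀ D.one_lt_norm

theorem zpow_lam_injective : Function.Injective fun k : ℤ => D.lam ^ k := by
  intro k l h
  have h : D.lam ^ k = D.lam ^ l := h
  by_contra hne
  rcases lt_or_gt_of_ne hne with hlt | hlt
  all_goals
    have := D.norm_zpow_lam_lt_iff.mpr hlt
    rw [h] at this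
    exact lt_irrefl _ this

/-- The annulus `|lam|⁻¹ < |w| < |lam|` contains no power of `lam` except `1`. -/
theorem isDiscrete_zpowers_lam : IsDiscrete (Subgroup.zpowers D.lam : Set ℂˣ) := by
  refine ⟨discreteTopology_of_isOpen_singleton_one (G := Subgroup.zpowers D.lam) ?_⟩
  have h : IsOpen {w : Subgroup.zpowers D.lam |
      ‖((w : ℂˣ) : ℂ)‖ < ‖((D.lam ^ (1 : ℤ) : ℂˣ) : ℂ)‖ ∧
      ‖((D.lam ^ (-1 : ℤ) : ℂˣ) : ℂ)‖ < ‖((w : ℂˣ) : ℂ)‖} := by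
    have hc : Continuous fun w : Subgroup.zpowers D.lam => ‖((w : ℂˣ) : ℂ)‖ :=
      (Units.continuous_val.comp continuous_subtype_val).norm
    exact (isOpen_lt hc continuous_const).inter (isOpen_lt continuous_const hc)
  convert h
  ext ⟨w, k, rfl⟩
  simp only [mem_singleton_iff, mem_ofPred_eq, norm_zpow_lam_lt_iff]
  constructor
  · intro h
    have h0 : D.lam ^ k = D.lam ^ (0 : ℤ) := by simpa using congrArg Subtype.val h
    have h1 := D.zpow_lam_injective h0
    subst h1
    simp
  · intro h
    obtain rfl : k = 0 := by omega
    simp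

theorem isQuotientCoveringMap_πH : IsQuotientCoveringMap D.πH (Subgroup.zpowers D.lam) :=
  Subgroup.isQuotientCoveringMap_of_comm _ D.isDiscrete_zpowers_lam

theorem isCoveringMap_πH : IsCoveringMap D.πH := D.isQuotientCoveringMap_πH.isCoveringMap

instance : T1Space D.H := by
  have : IsClosed (Subgroup.zpowers D.lam : Set ℂˣ) := by
    have := isDiscrete_iff_discreteTopology.mp D.isDiscrete_zpowers_lam
    exact Subgroup.isClosed_of_discrete
  infer_instance

theorem continuous_T_zpow (k : ℤ) : Continuous (D.T ^ k) := by
  refine continuous_induced_rng.mpr ?_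
  change Continuous fun p => ((D.T ^ k) p).1
  simp only [D.T_zpow]
  exact (continuous_const.mul (by fun_prop)).prodMk ((D.continuous_φ_zpow k).comp (by fun_prop))

/-- Neither coordinate separates orbits everywhere. On the axis `z = 0` the height is positive and
an interval `(a, φ a)` works; off the axis the modulus of `z` works, including at the boundary. -/
theorem exists_nhds_T_zpow (p : Cover) :
    ∃ U ∈ 𝓝 p, ∀ (k : ℤ) (q : Cover), q ∈ U → (D.T ^ k) q ∈ U → k = 0 := by
  have hL := D.one_lt_norm
  rcases eq_or_ne p.1.1 0 with hz | hz
  · have hx : 0 < p.1.2 := pos_iff_ne_zero.mpr fun h => p.2 (Prod.ext hz h)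
    obtain ⟨a, ha, ha'⟩ : ∃ a, D.φ.symm p.1.2 < a ∧ a < p.1.2 := by
      refine exists_between (lt_of_le_of_ne (D.φ_symm_le _) fun h => ?_)
      have h1 := D.expanding _ hx
      rw [D.φ.symm_apply_eq] at h
      exact h1.ne h
    have ha2 : p.1.2 < D.φ a := by
      have := D.strictMono_φ ha
      rwa [Equiv.apply_symm_apply] at this
    have hc : Continuous fun q : Cover => q.1.2 := by fun_prop
    refine ⟨{q | a < q.1.2 ∧ q.1.2 < D.φ a}, ((isOpen_lt continuous_const hc).inter
      (isOpen_lt hc continuous_const)).mem_nhds ⟨ha', ha2⟩, ?_⟩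
    rintro k q ⟨h1, h2⟩ ⟨h3, h4⟩
    rw [D.T_zpow] at h3 h4
    by_contra hk
    rcases lt_or_gt_of_ne hk with hk | hk
    · have h5 := D.φ_le_φ_zpow (neg_pos.mpr hk) ((D.φ ^ k) q.1.2)
      rw [D.φ_zpow_neg_apply] at h5
      exact absurd ((D.strictMono_φ h3).trans_le h5) h2.not_gt
    · exact absurd ((D.strictMono_φ h1).trans_le (D.φ_le_φ_zpow hk _)) h4.not_gt
  · have hr : 0 < ‖p.1.1‖ := norm_pos_iff.mpr hz
    have hc : Continuous fun q : Cover => ‖q.1.1‖ := by fun_prop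
    -- This is the annulus `|p| / √|lam| < |q| < √|lam| |p|`, squared to avoid roots; moduli in it
    -- have ratio less than `|lam|`.
    refine ⟨{q | ‖p.1.1‖ ^ 2 < ‖(D.lam : ℂ)‖ * ‖q.1.1‖ ^ 2 ∧
      ‖q.1.1‖ ^ 2 < ‖(D.lam : ℂ)‖ * ‖p.1.1‖ ^ 2}, ((isOpen_lt continuous_const
        (continuous_const.mul (hc.pow 2))).inter
      (isOpen_lt (hc.pow 2) continuous_const)).mem_nhds ⟨?_, ?_⟩, ?_⟩
    · exact lt_mul_of_one_lt_left (pow_pos hr 2) hL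
    · exact lt_mul_of_one_lt_left (pow_pos hr 2) hL
    rintro k q ⟨h1, h2⟩ ⟨h3, h4⟩
    rw [D.T_zpow] at h3 h4
    have hq : 0 < ‖q.1.1‖ := by
      rcases (norm_nonneg q.1.1).eq_or_lt with h | h
      · rw [← h] at h1; nlinarith [sq_nonneg ‖p.1.1‖]
      · exact h
    set L := ‖(D.lam : ℂ)‖ with hLdef
    have hn : ‖((D.lam ^ k : ℂˣ) : ℂ)‖ = L ^ k := by push_cast; rw [norm_zpow]
    simp only [norm_mul, hn] at h3 h4
    have hLk : 0 < L ^ k := zpow_pos (by linarith) k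
    have hL0 : (0 : ℝ) < L := by linarith
    have e1 : L ^ k * ‖q.1.1‖ < L * ‖q.1.1‖ := by
      refine lt_of_pow_lt_pow_left₀ 2 (by positivity) ?_
      calc (L ^ k * ‖q.1.1‖) ^ 2 < L * ‖p.1.1‖ ^ 2 := h4
        _ < L * (L * ‖q.1.1‖ ^ 2) := by gcongr
        _ = _ := by ring
    have e2 : ‖q.1.1‖ < L * (L ^ k * ‖q.1.1‖) := by
      refine lt_of_pow_lt_pow_left₀ 2 (by positivity) ?_
      calc ‖q.1.1‖ ^ 2 < L * ‖p.1.1‖ ^ 2 := h2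
        _ < L * (L * (L ^ k * ‖q.1.1‖) ^ 2) := by gcongr
        _ = _ := by ring
    have e3 : L ^ k < L ^ (1 : ℤ) := by simpa using lt_of_mul_lt_mul_right e1 hq.le
    have e4 : L ^ (0 : ℤ) < L ^ (1 + k) := by
      rw [zpow_add₀ hL0.ne', zpow_zero, zpow_one]
      refine lt_of_mul_lt_mul_right ?_ hq.le
      linarith
    rw [zpow_lt_zpow_iff_right₀ hL] at e3 e4
    omega

theorem isQuotientCoveringMap_π : IsQuotientCoveringMap D.π (Subgroup.zpowers D.T) where
  toIsQuotientMap := isQuotientMap_quot_mk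
  continuous_const_smul := by
    rintro ⟨_, k, rfl⟩
    exact D.continuous_T_zpow k
  apply_eq_iff_mem_orbit := Quotient.eq.trans (MulAction.orbitRel_apply)
  disjoint p := by
    obtain ⟨U, hU, h⟩ := D.exists_nhds_T_zpow p
    refine ⟨U, hU, ?_⟩
    rintro ⟨_, k, rfl⟩ ⟨_, ⟨q, hq, rfl⟩, hq'⟩
    obtain rfl := h k q hq hq'
    exact Subtype.ext (zpow_zero _)

theorem isCoveringMap_π : IsCoveringMap D.π := D.isQuotientCoveringMap_π.isCoveringMap

/-- A map between total spaces of `ℂ* → H` over the same map into `H` differ by a constant. -/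
theorem eq_zpow_lam_mul_of_lifts {A : Type*} [TopologicalSpace A] [PreconnectedSpace A]
    {F G : A → ℂˣ} (hF : Continuous F) (hG : Continuous G) (h : ∀ a, D.πH (F a) = D.πH (G a))
    (a₀ : A) : ∃ k : ℤ, ∀ a, F a = D.lam ^ k * G a := by
  obtain ⟨k, hk⟩ := D.πH_eq.mp (h a₀)
  refine ⟨k, fun a => ?_⟩
  refine congrFun (D.isCoveringMap_πH.eq_of_comp_eq hF (continuous_const.mul hG) ?_ a₀ hk.symm) a
  ext b
  exact (h b).trans (D.πH_eq.mpr ⟨-k, by simp [zpow_neg]⟩)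

theorem π_T_zpow (k : ℤ) (p : Cover) : D.π ((D.T ^ k) p) = D.π p := D.π_eq.mpr ⟨k, rfl⟩

theorem eq_T_zpow_of_lifts {A : Type*} [TopologicalSpace A] [PreconnectedSpace A]
    {F G : A → Cover} (hF : Continuous F) (hG : Continuous G) (h : ∀ a, D.π (F a) = D.π (G a))
    (a₀ : A) : ∃ k : ℤ, ∀ a, F a = (D.T ^ k) (G a) := by
  obtain ⟨k, hk⟩ := D.π_eq.mp (h a₀)
  refine ⟨k, fun a => ?_⟩
  refine congrFun (D.isCoveringMap_π.eq_of_comp_eq hF ((D.continuous_T_zpow k).comp hG)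
    ?_ a₀ hk.symm) a
  ext b
  exact (h b).trans (D.π_T_zpow k _).symm

/-! ### Entire lifts of holomorphic maps of the elliptic curve -/

/-- The exponential as a map `ℂ → ℂ*`. -/
def expU (u : ℂ) : ℂˣ := Units.mk0 (Complex.exp u) (Complex.exp_ne_zero u)

theorem coe_expU (u : ℂ) : (expU u : ℂ) = Complex.exp u := rfl

theorem continuous_expU : Continuous expU := by
  rw [Units.isEmbedding_val₀.continuous_iff]
  exact Complex.continuous_exp

theorem expU_add (u v : ℂ) : expU (u + v) = expU u * expU v :=
  Units.ext (Complex.exp_add u v)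

theorem expU_zero : expU 0 = 1 := Units.ext Complex.exp_zero

theorem exists_expU (z : ℂˣ) : ∃ u, expU u = z :=
  ⟨Complex.log z, Units.ext (Complex.exp_log z.ne_zero)⟩

theorem expU_int_mul (k : ℤ) (u : ℂ) : expU (k * u) = expU u ^ k := by
  refine Units.ext ?_
  push_cast
  exact Complex.exp_int_mul u k

/-- The logarithm of the multiplier. -/
def logLam : ℂ := Complex.log D.lam

theorem expU_logLam : expU D.logLam = D.lam := Units.ext (Complex.exp_log D.lam.ne_zero)

theorem logLam_re_pos : 0 < D.logLam.re := by
  rw [logLam, Complex.log_re]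
  exact Real.log_pos D.one_lt_norm

/-- The period `k log lam + 2πi m` of the covering `ℂ → H`. -/
def period (k m : ℤ) : ℂ := k * D.logLam + m * (2 * Real.pi * Complex.I)

theorem expU_period (k m : ℤ) : expU (D.period k m) = D.lam ^ k := by
  have : expU (2 * Real.pi * Complex.I) = 1 := Units.ext Complex.exp_two_pi_mul_I
  rw [period, expU_add, expU_int_mul, expU_int_mul, this, one_zpow, mul_one, expU_logLam]

theorem exists_period_of_expU_eq {u : ℂ} {k : ℤ} (h : expU u = D.lam ^ k) :
    ∃ m, u = D.period k m := by
  have h1 : expU u = expU (k * D.logLam) := by rw [h, expU_int_mul, expU_logLam]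
  obtain ⟨m, hm⟩ := Complex.exp_eq_exp_iff_exists_int.mp (congrArg Units.val h1)
  exact ⟨m, hm⟩

/-- Since `Re log lam > 0`, the numbers `log lam` and `2πi` form a real basis of `ℂ`; rounding down
both coordinates leaves a remainder in the fundamental parallelogram. -/
theorem exists_norm_sub_period_le (u : ℂ) :
    ∃ k m : ℤ, ‖u - D.period k m‖ ≤ ‖D.logLam‖ + 2 * Real.pi := by
  set a : ℝ := u.re / D.logLam.re with ha
  set b : ℝ := (u - a * D.logLam).im / (2 * Real.pi) with hb
  have hre := D.logLam_re_pos
  have hu : u = a * D.logLam + b * (2 * Real.pi * Complex.I) := by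
    apply Complex.ext
    · simp only [Complex.add_re, Complex.mul_re, Complex.ofReal_re, Complex.ofReal_im,
        Complex.I_re, Complex.I_im, Complex.re_ofNat, Complex.im_ofNat, Complex.mul_im]
      rw [ha]; field_simp; ring
    · have h2 : b * (2 * Real.pi) = (u - a * D.logLam).im := by
        rw [hb]; field_simp
      simp only [Complex.sub_im, Complex.add_im, Complex.mul_im, Complex.mul_re, Complex.ofReal_re,
        Complex.ofReal_im, Complex.I_re, Complex.I_im, Complex.re_ofNat, Complex.im_ofNat] at h2 ⊢
      linarith
  refine ⟨⌊a⌋, ⌊b⌋, ?_⟩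
  have e : u - D.period ⌊a⌋ ⌊b⌋ = (Int.fract a : ℝ) * D.logLam +
      (Int.fract b : ℝ) * (2 * Real.pi * Complex.I) := by
    conv_lhs => rw [hu]
    rw [period, Int.fract, Int.fract]
    push_cast
    ring
  rw [e]
  refine (norm_add_le _ _).trans (add_le_add ?_ ?_)
  · rw [norm_mul, Complex.norm_real, Real.norm_of_nonneg (Int.fract_nonneg a)]
    exact mul_le_of_le_one_left (norm_nonneg _) (Int.fract_lt_one a).le
  · have : ‖(2 * Real.pi * Complex.I : ℂ)‖ = 2 * Real.pi := by
      simp [abs_of_pos Real.pi_pos]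
    rw [norm_mul, Complex.norm_real, Real.norm_of_nonneg (Int.fract_nonneg b), this]
    exact mul_le_of_le_one_left (by positivity) (Int.fract_lt_one b).le

theorem πH_mul (z w : ℂˣ) : D.πH (z * w) = D.πH z * D.πH w := rfl

theorem πH_zpow_lam_mul (k : ℤ) (z : ℂˣ) : D.πH (D.lam ^ k * z) = D.πH z :=
  D.πH_eq.mpr ⟨k, rfl⟩

theorem exists_πH_expU (h : D.H) : ∃ u, D.πH (expU u) = h := by
  obtain ⟨z, rfl⟩ := D.πH_surjective h
  obtain ⟨u, rfl⟩ := exists_expU z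
  exact ⟨u, rfl⟩

theorem πH_expU_add_period (u : ℂ) (k m : ℤ) :
    D.πH (expU (u + D.period k m)) = D.πH (expU u) := by
  rw [expU_add, expU_period, mul_comm, πH_zpow_lam_mul]

theorem continuous_πH_expU : Continuous fun u => D.πH (expU u) :=
  continuous_πH.comp continuous_expU

instance : CompactSpace D.H := by
  have h : (fun u => D.πH (expU u)) '' Metric.closedBall 0 (‖D.logLam‖ + 2 * Real.pi) = univ := by
    refine eq_univ_of_forall fun h => ?_
    obtain ⟨u, rfl⟩ := D.exists_πH_expU h
    obtain ⟨k, m, hu⟩ := D.exists_norm_sub_period_le u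
    refine ⟨u - D.period k m, by simpa using hu, ?_⟩
    change D.πH (expU (u - D.period k m)) = _
    rw [← D.πH_expU_add_period _ k m, sub_add_cancel]
  exact ⟨h ▸ (isCompact_closedBall _ _).image D.continuous_πH_expU⟩

instance : ConnectedSpace D.H := by
  have : Function.Surjective fun u => D.πH (expU u) := D.exists_πH_expU
  exact this.connectedSpace D.continuous_πH_expU

variable {D}

theorem exists_lift_expU {g : D.H → D.H} (hg : Continuous g) :
    ∃ G : C(ℂ, ℂˣ), ∀ u, D.πH (G u) = g (D.πH (expU u)) := by
  obtain ⟨e, he⟩ := D.πH_surjective (g (D.πH (expU 0)))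
  obtain ⟨G, ⟨-, hG⟩, -⟩ := D.isCoveringMap_πH.existsUnique_continuousMap_lifts
    ⟨fun u => g (D.πH (expU u)), hg.comp D.continuous_πH_expU⟩ 0 e he
  exact ⟨G, congrFun hG⟩

/-- Near `u`, the lift `G` and `lam^k * F(exp u)` cover the same map and agree at `u`; local
injectivity of the covering makes them equal there. -/
theorem differentiable_lift_expU {g : D.H → D.H} (hg : D.IsHolomorphic g) {G : ℂ → ℂˣ}
    (hG : Continuous G) (h : ∀ u, D.πH (G u) = g (D.πH (expU u))) :
    Differentiable ℂ fun u => (G u : ℂ) := by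
  intro u
  obtain ⟨F, hF, hF'⟩ := hg (expU u)
  obtain ⟨v, hv, hgv⟩ := hF'.self_of_nhds
  obtain ⟨f, hf⟩ := exists_liftH hF'
  have hft : Tendsto f (𝓝 (expU u)) (𝓝 v) :=
    tendsto_liftH hF.continuousAt hv (hf.mono fun _ h => h.1)
  obtain ⟨k, hk⟩ := D.πH_eq.mp ((h u).trans hgv)
  obtain ⟨U, hU, hUinj⟩ := isLocallyInjective_iff_nhds.mp
    D.isCoveringMap_πH.isLocalHomeomorph.isLocallyInjective (G u)
  have hexp := continuous_expU.tendsto u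
  have ht : Tendsto (fun w => D.lam ^ k * f (expU w)) (𝓝 u) (𝓝 (G u)) := by
    rw [← hk]
    exact tendsto_const_nhds.mul (hft.comp hexp)
  have heq : (fun w => (G w : ℂ)) =ᶠ[𝓝 u]
      fun w => ((D.lam ^ k : ℂˣ) : ℂ) * F (Complex.exp w) := by
    filter_upwards [hG.continuousAt.eventually hU, ht.eventually hU, hexp.eventually hf]
      with w h1 h2 h3
    have h4 : G w = D.lam ^ k * f (expU w) := by
      refine hUinj h1 h2 ?_
      rw [h, h3.2, πH_zpow_lam_mul]
    rw [h4, Units.val_mul, h3.1, coe_expU]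
  refine DifferentiableAt.congr_of_eventuallyEq ?_ heq
  have hF2 : DifferentiableAt ℂ F (Complex.exp u) := hF.differentiableAt
  exact (hF2.comp u Complex.differentiable_exp.differentiableAt).const_mul _

theorem exists_lift_add_period {g : D.H → D.H} {G : ℂ → ℂˣ}
    (hG : Continuous G) (h : ∀ u, D.πH (G u) = g (D.πH (expU u))) (k m : ℤ) :
    ∃ l : ℤ, ∀ u, G (u + D.period k m) = D.lam ^ l * G u :=
  D.eq_zpow_lam_mul_of_lifts (hG.comp (continuous_add_const _)) hG
    (fun u => by rw [h, h, πH_expU_add_period]) 0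

/-- A holomorphic self-map of the elliptic curve lifts to an affine map of `ℂ`. -/
theorem IsHolomorphic.exists_affine_lift {g : D.H → D.H} (hg : D.IsHolomorphic g) :
    ∃ α β : ℂ, ∀ u, g (D.πH (expU u)) = D.πH (expU (α * u + β)) := by
  obtain ⟨G, hG⟩ := exists_lift_expU hg.continuous
  have hd := differentiable_lift_expU hg G.continuous hG
  set f : ℂ → ℂ := fun u => (G u : ℂ) with hf
  have hf0 : ∀ u, f u ≠ 0 := fun u => (G u).ne_zero
  have hld : Differentiable ℂ (logDeriv f) := by
    have : Differentiable ℂ (deriv f) := fun u =>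
      ((hd.analyticAt u).deriv).differentiableAt
    exact this.div hd hf0
  -- Translating by a period multiplies the lift by a constant, which the logarithmic derivative
  -- does not see. It is thus an entire doubly periodic function, hence constant.
  have hper : ∀ (k m : ℤ) (u : ℂ), logDeriv f (u - D.period k m) = logDeriv f u := by
    intro k m u
    obtain ⟨l, hl⟩ := exists_lift_add_period G.continuous hG k m
    have e : (fun w => f (w + D.period k m)) = fun w => ((D.lam ^ l : ℂˣ) : ℂ) * f w := by
      ext w
      simp only [hf, hl, Units.val_mul]
    have e1 := congrArg (fun F => deriv F (u - D.period k m)) e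
    have e2 := congrFun e (u - D.period k m)
    simp only [deriv_comp_add_const, deriv_const_mul_field, sub_add_cancel] at e1 e2
    rw [logDeriv_apply, logDeriv_apply, e1, e2, mul_div_mul_left _ _ (Units.ne_zero _)]
  have hbdd : Bornology.IsBounded (range (logDeriv f)) := by
    refine ((isCompact_closedBall (0 : ℂ) (‖D.logLam‖ + 2 * Real.pi)).image
      hld.continuous).isBounded.subset ?_
    rintro _ ⟨u, rfl⟩
    obtain ⟨k, m, hu⟩ := D.exists_norm_sub_period_le u
    exact ⟨u - D.period k m, by simpa using hu, hper k m u⟩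
  have hconst := fun u => hld.apply_eq_apply_of_bounded hbdd u 0
  set α := logDeriv f 0
  have hder : ∀ u, deriv f u = α * f u := fun u => by
    rw [← hconst u, logDeriv_apply, div_mul_cancel₀ _ (hf0 u)]
  have hlin : ∀ u, f u * Complex.exp (-(α * u)) = f 0 * Complex.exp (-(α * 0)) := by
    have hd2 : ∀ u, HasDerivAt (fun u => f u * Complex.exp (-(α * u))) 0 u := by
      intro u
      have h1 : HasDerivAt (fun u : ℂ => -(α * u)) (-(α * 1)) u :=
        ((hasDerivAt_id u).const_mul α).neg
      have h2 := (hd u).hasDerivAt.mul h1.cexp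
      refine h2.congr_deriv ?_
      rw [hder]
      ring
    exact fun u => is_const_of_deriv_eq_zero (fun u => (hd2 u).differentiableAt)
      (fun u => (hd2 u).deriv) u 0
  obtain ⟨β, hβ⟩ := exists_expU (G 0)
  refine ⟨α, β, fun u => ?_⟩
  rw [← hG]
  congr 1
  refine Units.ext ?_
  have h0 : f 0 = Complex.exp β := by rw [hf]; simp only [← hβ, coe_expU]
  have h1 := hlin u
  rw [h0, mul_zero, neg_zero, Complex.exp_zero, mul_one, Complex.exp_neg,
    mul_inv_eq_iff_eq_mul₀ (Complex.exp_ne_zero _), ← Complex.exp_add] at h1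
  rw [coe_expU, add_comm]
  exact h1

/-- The linear part of an affine lift maps periods to periods. -/
theorem exists_mul_period {g : D.H → D.H} {α β : ℂ}
    (h : ∀ u, g (D.πH (expU u)) = D.πH (expU (α * u + β))) (k m : ℤ) :
    ∃ k' m', α * D.period k m = D.period k' m' := by
  obtain ⟨l, hl⟩ := exists_lift_add_period (g := g) (G := fun u => expU (α * u + β))
    (continuous_expU.comp (by fun_prop)) (fun u => (h u).symm) k m
  have h0 := hl 0
  rw [mul_add, mul_zero, zero_add, zero_add, expU_add, mul_left_inj] at h0
  exact ⟨l, D.exists_period_of_expU_eq h0⟩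

theorem period_injective {k m k' m' : ℤ} (h : D.period k m = D.period k' m') :
    k = k' ∧ m = m' := by
  have h1 : k = k' := D.zpow_lam_injective (by
    change D.lam ^ k = D.lam ^ k'
    rw [← expU_period, ← expU_period, h])
  subst h1
  refine ⟨rfl, ?_⟩
  rw [period, period, add_right_inj] at h
  exact_mod_cast mul_right_cancel₀ Complex.two_pi_I_ne_zero h

theorem eq_translation_of_linear_part_one {g : D.H → D.H} {β : ℂ}
    (h : ∀ u, g (D.πH (expU u)) = D.πH (expU (1 * u + β))) :
    ∃ t : D.H, ∀ x, g x = t * x := by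
  refine ⟨D.πH (expU β), fun x => ?_⟩
  obtain ⟨u, rfl⟩ := D.exists_πH_expU x
  rw [h, one_mul, add_comm, expU_add, πH_mul]

/-- An injective map with an affine lift whose linear part maps periods of exponent `-1` to
periods of negative exponent is a translation. -/
theorem eq_translation_of_affine_lift {g : D.H → D.H} (hinj : Function.Injective g) {α β : ℂ}
    (h : ∀ u, g (D.πH (expU u)) = D.πH (expU (α * u + β)))
    (hdir : ∀ m k' m' : ℤ, α * D.period (-1) m = D.period k' m' → k' < 0) :
    ∃ t : D.H, ∀ x, g x = t * x := by
  obtain ⟨p, q, hpq⟩ := exists_mul_period h 0 1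
  obtain ⟨r, s, hrs⟩ := exists_mul_period h (-1) 0
  -- Here `p` and `r` are the exponents of the images of the periods `(0, 1)` and `(-1, 0)`.
  have hlin : ∀ m : ℤ, r + m * p < 0 := fun m =>
    hdir m (r + m * p) (s + m * q) (by
      have e : D.period (-1) m = D.period (-1) 0 + m * D.period 0 1 := by
        simp only [period]; push_cast; ring
      rw [e, mul_add, mul_left_comm, hpq, hrs]
      simp only [period]; push_cast; ring)
  have hp : p = 0 := by
    by_contra hp
    -- With `m = -r * p` the exponent is `r (1 - p²)`, which is nonnegative because `r < 0` and `p²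
    -- ≥ 1`.
    have h1 := hlin (-r * p)
    have h2 : 1 ≤ p * p := by
      have := mul_self_pos.mpr hp
      omega
    have h3 := hlin 0
    nlinarith
  subst hp
  have hα : α = q := by
    have e : α * (2 * Real.pi * Complex.I) = q * (2 * Real.pi * Complex.I) := by
      simpa [period] using hpq
    exact mul_right_cancel₀ Complex.two_pi_I_ne_zero e
  have hr : r = -q := by
    refine (period_injective (D := D) (m := 0) (m' := s) ?_).1.symm
    rw [← hrs, hα]
    simp only [period]; push_cast; ring
  have hq : 0 < q := by have := hlin 0; omega
  have hq1 : q = 1 := by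
    have hq0 : (q : ℂ) ≠ 0 := by exact_mod_cast hq.ne'
    -- Multiplication by `q` sends `2πi / q` to a period, so injectivity makes `2πi / q` itself a
    -- period; comparing coefficients, `q` divides `1`.
    have h1 : D.πH (expU (2 * Real.pi * Complex.I / q)) = D.πH (expU 0) := by
      apply hinj
      rw [h, h, hα, mul_div_cancel₀ _ hq0, mul_zero, zero_add, ← D.πH_expU_add_period β 0 1, period]
      congr 2
      push_cast; ring
    rw [expU_zero] at h1
    obtain ⟨k, hk⟩ := D.πH_eq.mp h1
    rw [mul_one] at hk
    obtain ⟨m, hm⟩ := D.exists_period_of_expU_eq hk.symm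
    have h2 : D.period 0 1 = D.period (q * k) (q * m) := by
      rw [div_eq_iff hq0] at hm
      simp only [period] at hm ⊢
      push_cast
      linear_combination hm
    have h3 := (period_injective h2).2
    exact Int.eq_one_of_dvd_one hq.le ⟨m, h3⟩
  subst hq1
  rw [hα, Int.cast_one] at h
  exact eq_translation_of_linear_part_one h

/-- If the linear part of an affine lift is not `1`, then the difference to the identity is
surjective. -/
theorem surjective_mul_inv_of_affine_lift {g : D.H → D.H} {α β : ℂ} (hα : α ≠ 1)
    (h : ∀ u, g (D.πH (expU u)) = D.πH (expU (α * u + β))) :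
    Function.Surjective fun x => g x * x⁻¹ := by
  intro y
  obtain ⟨v, rfl⟩ := D.exists_πH_expU y
  -- The solution `u` of `αu + β - u = v`.
  refine ⟨D.πH (expU ((v - β) / (α - 1))), ?_⟩
  have hα' := sub_ne_zero.mpr hα
  simp only
  rw [h, mul_inv_eq_iff_eq_mul, ← πH_mul, ← expU_add]
  congr 2
  field_simp
  ring

variable (D)

/-! ### Translations form the identity component -/

theorem isHolomorphic_mul_left (t : D.H) : D.IsHolomorphic fun h => t * h := by
  obtain ⟨a, rfl⟩ := D.πH_surjective t
  exact fun _ => ⟨fun w => a * w, analyticAt_const.mul analyticAt_id,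
    Eventually.of_forall fun w => ⟨a * w, rfl, rfl⟩⟩

/-- The translation of the elliptic curve by `t`. -/
def translation (t : D.H) : D.AutH :=
  ⟨Homeomorph.mulLeft t, D.isHolomorphic_mul_left t, D.isHolomorphic_mul_left t⁻¹⟩

theorem continuous_translation : Continuous D.translation := by
  refine continuous_induced_rng.mpr ?_
  refine ContinuousMap.continuous_of_continuous_uncurry _ ?_
  exact continuous_mul (M := D.H)

/-- The set of translations of the elliptic curve. -/
def translations : Set D.AutH := {g | ∃ t : D.H, ∀ h, g.1 h = t * h}

theorem range_translation : range D.translation = D.translations := by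
  ext g
  constructor
  · rintro ⟨t, rfl⟩
    exact ⟨t, fun h => rfl⟩
  · rintro ⟨t, ht⟩
    exact ⟨t, Subtype.ext (Homeomorph.ext fun h => (ht h).symm)⟩

theorem one_mem_translations : (1 : D.AutH) ∈ D.translations := ⟨1, fun h => (one_mul h).symm⟩

theorem translations_subset_Aut₀H : D.translations ⊆ D.Aut₀H := by
  have hp : IsPreconnected D.translations := by
    rw [← range_translation]
    exact isPreconnected_range D.continuous_translation
  exact hp.subset_connectedComponent D.one_mem_translations

/-- The class of `-1` serves only as a point other than `1`, to be omitted by `x ↦ g x * x⁻¹` for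
`g` near the identity. -/
theorem πH_neg_one_ne_one : D.πH (-1) ≠ 1 := by
  intro h
  obtain ⟨k, hk⟩ := D.πH_eq.mp (show D.πH (-1) = D.πH 1 from h)
  rw [mul_one] at hk
  have hn : ‖((D.lam ^ k : ℂˣ) : ℂ)‖ = ‖((D.lam ^ (0 : ℤ) : ℂˣ) : ℂ)‖ := by
    rw [hk]; simp
  have h0 : k = 0 := by
    by_contra hne
    rcases lt_or_gt_of_ne hne with hlt | hlt
    · exact (D.norm_zpow_lam_lt_iff.mpr hlt).ne hn
    · exact (D.norm_zpow_lam_lt_iff.mpr hlt).ne' hn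
  subst h0
  have h2 := congrArg Units.val hk
  norm_num at h2

theorem mem_translations_of_forall_ne (g : D.AutH)
    (h : ∀ x, g.1 x * x⁻¹ ≠ D.πH (-1)) : g ∈ D.translations := by
  obtain ⟨α, β, hαβ⟩ := g.2.1.exists_affine_lift
  rcases eq_or_ne α 1 with rfl | hα
  · exact eq_translation_of_linear_part_one hαβ
  · obtain ⟨x, hx⟩ := surjective_mul_inv_of_affine_lift hα hαβ (D.πH (-1))
    exact absurd hx (h x)

/-- The displacement of `g₀⁻¹ * g` depends continuously on `g` and is constantly `1` at `g = g₀`.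
Since `H` is compact, omitting `[-1]` is an open condition in the compact-open topology. Hence being
a translation is locally constant on `Aut H`. -/
theorem exists_isOpen_inv_mul_mem_translations (g₀ : D.AutH) :
    ∃ O : Set D.AutH, IsOpen O ∧ g₀ ∈ O ∧ ∀ g ∈ O, g₀⁻¹ * g ∈ D.translations := by
  let Φ : D.AutH → C(D.H, D.H) := fun g =>
    ((g₀⁻¹ : D.AutH).1 : C(D.H, D.H)).comp (g.1 : C(D.H, D.H)) * ⟨fun x => x⁻¹, continuous_inv⟩
  have hΦ : Continuous Φ := by
    have h : Continuous fun g : D.AutH => (g.1 : C(D.H, D.H)) := continuous_induced_dom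
    exact ((ContinuousMap.continuous_postcomp ((g₀⁻¹ : D.AutH).1 : C(D.H, D.H))).comp h).mul
      continuous_const
  refine ⟨Φ ⁻¹' {F | MapsTo F univ {D.πH (-1)}ᶜ}, (ContinuousMap.isOpen_setOfPred_mapsTo
    isCompact_univ isOpen_compl_singleton).preimage hΦ, ?_, ?_⟩
  · intro x _ hx
    have h1 : ∀ x, (g₀⁻¹ : D.AutH).1 (g₀.1 x) = x := fun x => g₀.1.symm_apply_apply x
    have h2 : (g₀⁻¹ : D.AutH).1 (g₀.1 x) * x⁻¹ = D.πH (-1) := hx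
    rw [h1, mul_inv_cancel] at h2
    exact D.πH_neg_one_ne_one h2.symm
  · exact fun g hg => D.mem_translations_of_forall_ne _ fun x => hg (mem_univ x)

theorem apply_inv_mul_apply (g₀ g : D.AutH) (x : D.H) : g₀.1 ((g₀⁻¹ * g).1 x) = g.1 x :=
  g₀.1.apply_symm_apply _

theorem isClopen_translations : IsClopen D.translations := by
  constructor
  · refine ⟨isOpen_iff_mem_nhds.mpr fun g₀ hg₀ => ?_⟩
    obtain ⟨O, hO, hmem, h⟩ := D.exists_isOpen_inv_mul_mem_translations g₀
    refine mem_of_superset (hO.mem_nhds hmem) fun g hg hgt => hg₀ ?_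
    obtain ⟨t, ht⟩ := h g hg
    obtain ⟨s, hs⟩ := hgt
    refine ⟨s * t⁻¹, fun x => ?_⟩
    have h1 := D.apply_inv_mul_apply g₀ g (t⁻¹ * x)
    rw [ht, hs, mul_inv_cancel_left, ← mul_assoc] at h1
    exact h1
  · refine isOpen_iff_mem_nhds.mpr fun g₀ hg₀ => ?_
    obtain ⟨O, hO, hmem, h⟩ := D.exists_isOpen_inv_mul_mem_translations g₀
    refine mem_of_superset (hO.mem_nhds hmem) fun g hg => ?_
    obtain ⟨t, ht⟩ := h g hg
    obtain ⟨s, hs⟩ := hg₀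
    refine ⟨s * t, fun x => ?_⟩
    rw [← D.apply_inv_mul_apply g₀ g, ht, hs, mul_assoc]

theorem Aut₀H_eq_translations : D.Aut₀H = D.translations :=
  (D.isClopen_translations.connectedComponent_subset D.one_mem_translations).antisymm
    D.translations_subset_Aut₀H

/-! ### Automorphisms preserving the direction of the holonomy -/

variable {D}

/-- The segment from `0` to the period `(-1, m)` projects to a loop with holonomy `φ`. Its image
lifts to a path whose endpoint is `lam^k'` times its origin, so the image holonomy is `φ^(-k')`, and
it expands only if `k' < 0`. -/
theorem PreservesHolonomyDirection.period_neg {g : D.AutH} (hg : D.PreservesHolonomyDirection g)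
    {α β : ℂ} (h : ∀ u, g.1 (D.πH (expU u)) = D.πH (expU (α * u + β))) {m k' m' : ℤ}
    (hper : α * D.period (-1) m = D.period k' m') : k' < 0 := by
  set per := D.period (-1) m with hper₀
  let c : C(unitInterval, ℂˣ) := ⟨fun t => expU ((t : ℝ) * per), continuous_expU.comp (by fun_prop)⟩
  have hc0 : c 0 = 1 := by simp [c, expU_zero]
  have hc1 : c 1 = D.lam⁻¹ := by simp [c, hper₀, expU_period]
  let γ : Path (D.πH 1) (D.πH 1) :=
    { toFun := fun t => D.πH (c t)
      continuous_toFun := continuous_πH.comp c.continuous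
      source' := by rw [hc0]
      target' := by
        rw [hc1]
        exact D.πH_eq.mpr ⟨-1, by simp⟩ }
  have hγ : D.HasExpandingHolonomy γ := by
    refine ⟨D.φ, ⟨c, fun t => rfl, fun x => D.π_eq.mpr ⟨-1, Subtype.ext ?_⟩⟩, D.expanding⟩
    rw [D.T_zpow]
    refine Prod.ext ?_ ?_
    · simp [hc0, hc1]
    · simp
  obtain ⟨h', ⟨c', hc', hol⟩, hexp⟩ := hg _ γ hγ
  -- The holonomy may be given by any lift `c'`; it differs from the affine one by a power of `lam`,
  -- which cancels in `c' 1 / c' 0`.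
  obtain ⟨l, hl⟩ := D.eq_zpow_lam_mul_of_lifts c'.continuous
    (G := fun t : unitInterval => expU (α * ((t : ℝ) * per) + β))
    (continuous_expU.comp (by fun_prop)) (fun t => (hc' t).trans (h _)) 0
  have hc1' : c' 1 = D.lam ^ k' * c' 0 := by
    rw [hl, hl, Icc.coe_one, Icc.coe_zero, Complex.ofReal_one,
      Complex.ofReal_zero, one_mul, zero_mul, mul_zero, zero_add, hper, expU_add, expU_period,
      mul_left_comm]
  obtain ⟨j, hj⟩ := D.π_eq.mp (hol 1)
  have hj := congrArg Subtype.val hj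
  rw [D.T_zpow, Prod.ext_iff] at hj
  have hj1 : D.lam ^ j * c' 0 = c' 1 := Units.ext hj.1
  have hj2 : (D.φ ^ j) (h' 1) = 1 := hj.2
  rw [hc1', mul_left_inj] at hj1
  obtain rfl := D.zpow_lam_injective hj1
  have h1 : h' 1 = (D.φ ^ (-j)) 1 := by
    rw [← D.φ_zpow_neg_apply j (h' 1), hj2]
  have h2 := hexp 1 zero_lt_one
  rw [h1, D.lt_φ_zpow_iff zero_lt_one] at h2
  omega

theorem PreservesHolonomyDirection.mem_Aut₀H {g : D.AutH}
    (hg : D.PreservesHolonomyDirection g) : g ∈ D.Aut₀H := by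
  rw [Aut₀H_eq_translations]
  obtain ⟨α, β, h⟩ := g.2.1.exists_affine_lift
  exact eq_translation_of_affine_lift g.1.injective h fun m k' m' => hg.period_neg h

/-! ### Restrictions of automorphisms of the Reeb component -/

theorem π_mem_leaf_iff {p : Cover} {x : ℝ≥0} : D.π p ∈ D.leaf x ↔ ∃ k : ℤ, p.1.2 = (D.φ ^ k) x := by
  constructor
  · rintro ⟨q, rfl, h⟩
    obtain ⟨k, rfl⟩ := D.π_eq.mp h.symm
    exact ⟨k, by rw [D.T_zpow]⟩
  · rintro ⟨k, hk⟩
    refine ⟨(D.T ^ (-k)) p, ?_, D.π_T_zpow _ _⟩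
    change ((D.T ^ (-k)) p).1.2 = x
    rw [D.T_zpow, hk, D.φ_zpow_neg_apply]

theorem π_mem_leaf_zero_iff {p : Cover} : D.π p ∈ D.leaf 0 ↔ p.1.2 = 0 := by
  simp [π_mem_leaf_iff, φ_zpow_zero]

/-- The point `(exp u, x)` of `R̃`. -/
def expPt (u : ℂ) (x : ℝ≥0) : Cover :=
  ⟨(Complex.exp u, x), fun h => Complex.exp_ne_zero u (congrArg Prod.fst h)⟩

theorem continuous_expPt {A : Type*} [TopologicalSpace A] {u : A → ℂ} {x : A → ℝ≥0}
    (hu : Continuous u) (hx : Continuous x) : Continuous fun a => expPt (u a) (x a) :=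
  ((Complex.continuous_exp.comp hu).prodMk hx).subtype_mk _

theorem π_expPt_add_period (u : ℂ) (k m : ℤ) (x : ℝ≥0) :
    D.π (expPt (u + D.period k m) ((D.φ ^ k) x)) = D.π (expPt u x) := by
  refine D.π_eq.mpr ⟨k, Subtype.ext ?_⟩
  rw [D.T_zpow]
  refine Prod.ext ?_ rfl
  have := congrArg Units.val (expU_add u (D.period k m))
  rw [expU_period, mul_comm] at this
  exact this.symm

/-- An automorphism of `R` lifts to the simply connected cover of `R̃` minus the axis `z = 0`. -/
theorem exists_lift_expPt (f : D.AutR) :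
    ∃ Γ : C(ℂ × ℝ, Cover), ∀ u x, D.π (Γ (u, x)) = f.1 (D.π (expPt u x.toNNReal)) := by
  have hc : Continuous fun q : ℂ × ℝ => f.1 (D.π (expPt q.1 q.2.toNNReal)) :=
    f.1.continuous.comp (continuous_π.comp
      (continuous_expPt continuous_fst (continuous_real_toNNReal.comp continuous_snd)))
  obtain ⟨e, he⟩ := D.isQuotientCoveringMap_π.surjective (f.1 (D.π (expPt 0 0)))
  obtain ⟨Γ, ⟨-, hΓ⟩, -⟩ := D.isCoveringMap_π.existsUnique_continuousMap_lifts
    ⟨_, hc⟩ (0, 0) e (by simpa using he)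
  exact ⟨Γ, fun u x => congrFun hΓ (u, x)⟩

/-- The points of a leaf have heights in one orbit of `φ`, which is countable and so totally
disconnected, while the height of the lift is continuous on the connected plane. -/
theorem height_lift_eq {f : D.AutR} {Γ : C(ℂ × ℝ, Cover)}
    (hΓ : ∀ u x, D.π (Γ (u, x)) = f.1 (D.π (expPt u x.toNNReal))) (u v : ℂ) (x : ℝ) :
    (Γ (u, x)).1.2 = (Γ (v, x)).1.2 := by
  obtain ⟨y, hy⟩ := f.2.1.foliation x.toNNReal
  have hsub : range (fun u => (Γ (u, x)).1.2) ⊆ range fun k : ℤ => (D.φ ^ k) y := by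
    rintro _ ⟨w, rfl⟩
    have : D.π (Γ (w, x)) ∈ D.leaf y := by
      rw [hΓ, ← hy]
      exact mem_image_of_mem _ ⟨_, rfl, rfl⟩
    obtain ⟨k, hk⟩ := π_mem_leaf_iff.mp this
    exact ⟨k, hk.symm⟩
  have hcont : Continuous fun u => (Γ (u, x)).1.2 := by fun_prop
  exact (countable_range _).isTotallyDisconnected _ hsub (isPreconnected_range hcont)
    (mem_range_self u) (mem_range_self v)

theorem height_lift_eq_zero_iff {f : D.AutR} {Γ : C(ℂ × ℝ, Cover)}
    (hΓ : ∀ u x, D.π (Γ (u, x)) = f.1 (D.π (expPt u x.toNNReal))) (u : ℂ) (x : ℝ≥0) :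
    (Γ (u, x)).1.2 = 0 ↔ x = 0 := by
  rw [← π_mem_leaf_zero_iff (D := D), hΓ, ← image_leaf_zero f, f.1.injective.mem_set_image,
    π_mem_leaf_zero_iff, Real.toNNReal_coe]
  rfl

theorem period_neg_of_AutR (f : D.AutR) {α β : ℂ}
    (h : ∀ u, (D.rH f).1 (D.πH (expU u)) = D.πH (expU (α * u + β))) {m k' m' : ℤ}
    (hper : α * D.period (-1) m = D.period k' m') : k' < 0 := by
  obtain ⟨Γ, hΓ⟩ := exists_lift_expPt f
  -- Over the boundary, `Γ` and the affine lift cover the same map, so they differ by a power of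
  -- `T`.
  obtain ⟨l, hl⟩ := D.eq_T_zpow_of_lifts (F := fun u : ℂ => Γ (u, 0))
    (G := fun u => expPt (α * u + β) 0) (by fun_prop)
    (continuous_expPt (by fun_prop) continuous_const) (fun u => by
      rw [hΓ, Real.toNNReal_zero]
      change f.1 (D.bdry (D.πH (expU u))) = D.bdry (D.πH (expU (α * u + β)))
      rw [← h, D.bdry_rH]) 0
  -- Precomposing `Γ` with the deck transformation of exponent `-1` amounts to composing it with
  -- some `T^j`; the boundary formula then identifies `j` with `k'`.
  obtain ⟨j, hj⟩ := D.eq_T_zpow_of_lifts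
    (F := fun q : ℂ × ℝ => Γ (q.1 + D.period (-1) m, ((D.φ ^ (-1 : ℤ)) q.2.toNNReal : ℝ≥0)))
    (G := fun q => Γ (q.1, (q.2.toNNReal : ℝ)))
    (Γ.continuous.comp ((by fun_prop : Continuous fun q : ℂ × ℝ => q.1 + D.period (-1) m).prodMk
      (NNReal.continuous_coe.comp ((D.continuous_φ_zpow (-1)).comp
        (continuous_real_toNNReal.comp continuous_snd)))))
    (Γ.continuous.comp (continuous_fst.prodMk (NNReal.continuous_coe.comp
      (continuous_real_toNNReal.comp continuous_snd))))
    (fun q => by rw [hΓ, hΓ, Real.toNNReal_coe, Real.toNNReal_coe, π_expPt_add_period]) (0, 0)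
  have hjk : j = k' := by
    have h1 := congrArg (fun p : Cover => p.1.1) (hj (0, 0))
    have h2 := fun u => congrArg (fun p : Cover => p.1.1) (hl u)
    simp only [D.T_zpow, Real.toNNReal_zero, φ_zpow_zero, NNReal.coe_zero, zero_add] at h1 h2
    rw [h2, h2, mul_zero, zero_add, hper] at h1
    have h3 : D.lam ^ l * expU (D.period k' m' + β) = D.lam ^ j * (D.lam ^ l * expU β) :=
      Units.ext h1
    rw [expU_add, expU_period, mul_left_comm, mul_left_inj] at h3
    exact (D.zpow_lam_injective h3).symm
  subst hjk
  by_contra! hj0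
  set y : ℝ≥0 → ℝ≥0 := fun x => (Γ (0, (x : ℝ))).1.2 with hy
  have hyc : Continuous y := by fun_prop
  -- As heights do not depend on `u`, the deck relation becomes `y ∘ φ⁻¹ = φ^j ∘ y`, and `φ^j` does
  -- not lower heights when `j ≥ 0`.
  have hstep : ∀ x, y x ≤ y (D.φ.symm x) := by
    intro x
    have h1 := congrArg (fun p : Cover => p.1.2) (hj (0, (x : ℝ)))
    simp only [D.T_zpow, Real.toNNReal_coe] at h1
    rw [height_lift_eq hΓ _ 0] at h1
    have h2 : y (D.φ.symm x) = (D.φ ^ j) (y x) := by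
      rw [hy]
      simp only
      rw [← h1]
      simp
    rw [h2]
    obtain ⟨n, rfl⟩ := Int.eq_ofNat_of_zero_le hj0
    exact D.le_φ_pow n _
  have hiter : ∀ n : ℕ, y 1 ≤ y (D.φ.symm^[n] 1) := by
    intro n
    induction n with
    | zero => exact le_rfl
    | succ n ih =>
      rw [Function.iterate_succ_apply']
      exact ih.trans (hstep _)
  have hy0 : y 0 = 0 := (height_lift_eq_zero_iff hΓ 0 0).mpr rfl
  have hlim := (hyc.tendsto 0).comp (D.tendsto_φ_symm_iterate 1)
  rw [hy0] at hlim
  have h1 : y 1 = 0 := le_antisymm (ge_of_tendsto' hlim hiter) zero_le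
  exact one_ne_zero ((height_lift_eq_zero_iff hΓ 0 1).mp h1)

theorem rH_mem_Aut₀H (f : D.AutR) : D.rH f ∈ D.Aut₀H := by
  rw [Aut₀H_eq_translations]
  obtain ⟨α, β, h⟩ := (D.rH f).2.1.exists_affine_lift
  exact eq_translation_of_affine_lift (D.rH f).1.injective h fun m k' m' => period_neg_of_AutR f h

/-! ### The automorphisms of `R` induced by `z ↦ a z` -/

/-- Multiplication by `a` commutes with multiplication by `lam` and leaves heights alone, so it
commutes with `T`. -/
theorem π_scale_eq (a : ℂˣ) {p q : Cover} (h : D.π p = D.π q) :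
    D.π (scale a p) = D.π (scale a q) := by
  obtain ⟨k, rfl⟩ := D.π_eq.mp h
  refine D.π_eq.mpr ⟨k, Subtype.ext ?_⟩
  rw [D.T_zpow]
  simp only [scale, D.T_zpow]
  rw [mul_left_comm]

variable (D) in
/-- The map of `R` induced by `m_a × id`. -/
def scaleFun (a : ℂˣ) : D.R → D.R :=
  Quotient.lift (fun p => D.π (scale a p)) fun _ _ h => π_scale_eq a (Quotient.sound h)

theorem scaleFun_π (a : ℂˣ) (p : Cover) : D.scaleFun a (D.π p) = D.π (scale a p) := rfl

theorem scale_scale (a b : ℂˣ) (p : Cover) : scale a (scale b p) = scale (a * b) p :=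
  Subtype.ext (Prod.ext (by simp [scale, mul_assoc]) rfl)

theorem scale_one (p : Cover) : scale 1 p = p :=
  Subtype.ext (Prod.ext (by simp [scale]) rfl)

theorem continuous_scaleFun (a : ℂˣ) : Continuous (D.scaleFun a) := by
  refine continuous_quot_lift _ (continuous_π.comp ?_)
  exact Continuous.subtype_mk (by fun_prop) _

theorem scaleFun_scaleFun_of_mul_eq_one {a b : ℂˣ} (h : a * b = 1) (r : D.R) :
    D.scaleFun a (D.scaleFun b r) = r := by
  obtain ⟨p, rfl⟩ := D.isQuotientCoveringMap_π.surjective r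
  rw [scaleFun_π, scaleFun_π, scale_scale, h, scale_one]

theorem image_scaleFun_leaf (a : ℂˣ) (x : ℝ≥0) : D.scaleFun a '' D.leaf x = D.leaf x := by
  refine Subset.antisymm ?_ ?_
  · rintro _ ⟨_, ⟨p, hp, rfl⟩, rfl⟩
    exact ⟨scale a p, hp, rfl⟩
  · rintro _ ⟨p, hp, rfl⟩
    exact ⟨D.π (scale a⁻¹ p), ⟨scale a⁻¹ p, hp, rfl⟩,
      scaleFun_scaleFun_of_mul_eq_one (mul_inv_cancel a) (D.π p)⟩

theorem isFoliatedHolomorphic_scaleFun (a : ℂˣ) : D.IsFoliatedHolomorphic (D.scaleFun a) where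
  smooth p := ⟨fun q => (a * q.1, q.2), by fun_prop,
    Eventually.of_forall fun q => ⟨scale a q, rfl, rfl⟩⟩
  foliation x := ⟨x, image_scaleFun_leaf a x⟩
  holomorphic p := ⟨fun w => a * w, p.1.2, analyticAt_const.mul analyticAt_id,
    Eventually.of_forall fun _ hw => ⟨(scale a ⟨_, hw⟩).2, rfl⟩⟩

variable (D) in
/-- The automorphism of `R` induced by `m_a × id`. -/
def scaleAut (a : ℂˣ) : D.AutR :=
  ⟨{ toFun := D.scaleFun a
     invFun := D.scaleFun a⁻¹
     left_inv := scaleFun_scaleFun_of_mul_eq_one (inv_mul_cancel a)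
     right_inv := scaleFun_scaleFun_of_mul_eq_one (mul_inv_cancel a)
     continuous_toFun := continuous_scaleFun a
     continuous_invFun := continuous_scaleFun a⁻¹ },
    isFoliatedHolomorphic_scaleFun a, isFoliatedHolomorphic_scaleFun a⁻¹⟩

theorem rH_scaleAut (a : ℂˣ) (h : D.H) : (D.rH (D.scaleAut a)).1 h = D.πH a * h := by
  apply D.bdry_injective
  obtain ⟨z, rfl⟩ := D.πH_surjective h
  rw [D.bdry_rH, ← πH_mul, bdry_πH, bdry_πH]
  exact congrArg D.π (Subtype.ext rfl)

end HopfData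

end

theorem proposition3p1 (D : HopfData) :
    -- the image of the restriction map is exactly the identity component
    Set.range D.rH = D.Aut₀H ∧
    -- no automorphism of `H` outside `Aut₀ H` preserves the direction of the holonomy
    (∀ g : D.AutH, g ∉ D.Aut₀H → ¬ D.PreservesHolonomyDirection g) ∧
    -- the elements of `Aut₀ H` are the translations of the elliptic curve
    (∀ g : D.AutH, g ∈ D.Aut₀H ↔ ∃ t : D.H, ∀ h : D.H, g.1 h = t * h) ∧
    -- every translation comes from some `m_a : z ↦ a z`, where `m_a × id` descends to `R`
    (∀ t : D.H, ∃ a : ℂˣ, (∀ z : ℂˣ, t * D.πH z = D.πH (a * z)) ∧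
      ∃ f : D.AutR, (∀ p : HopfData.Cover, f.1 (D.π p) = D.π (HopfData.scale a p)) ∧
        ∀ h : D.H, (D.rH f).1 h = t * h) := by
  refine ⟨?_, fun g hg hp => hg hp.mem_Aut₀H, fun g => by
    rw [HopfData.Aut₀H_eq_translations]; rfl, fun t => ?_⟩
  · refine Set.Subset.antisymm ?_ fun g hg => ?_
    · rintro _ ⟨f, rfl⟩
      exact HopfData.rH_mem_Aut₀H f
    · rw [HopfData.Aut₀H_eq_translations] at hg
      obtain ⟨t, ht⟩ := hg
      obtain ⟨a, rfl⟩ := D.πH_surjective t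
      exact ⟨D.scaleAut a, Subtype.ext (Homeomorph.ext fun h =>
        (HopfData.rH_scaleAut a h).trans (ht h).symm)⟩
  · obtain ⟨a, rfl⟩ := D.πH_surjective t
    exact ⟨a, fun z => rfl, D.scaleAut a, fun p => rfl, HopfData.rH_scaleAut a⟩
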